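/- Let $(X,\mathcal A,\mu)$ be a non-atomic $\sigma$-finite measure space (non-atomic: every $A\in\mathcal A$ with $\mu(A)>0$ contains some $B\in\mathcal A$ with $0<\mu(B)<\mu(A)$), and let $m\in\mathbb N$. Let $F$ be a set-valued mapping that assigns to each $x\in X$ a nonempty compact convex set $F(x)\subset\mathbb R^m$ and that is measurable, i.e. $\{x\in X: F(x)\cap U\neq\emptyset\}\in\mathcal A$ for every open $U\subset\mathbb R^m$. Let $L^1(X)^m$ denote the space of ($\mu$-a.e. classes of) integrable functions $g:X\to\mathbb R^m$ with norm $|g|_{L^1(X)^m}=\int_X|g(x)|\,d\mu(x)$, where $|\cdot|$ is the Euclidean norm on $\mathbb R^m$, and let $f\in L^1(X)^m$ satisfy $f(x)\in F(x)$ for a.e. $x\in X$. Suppose that there exists a set $E\in\mathcal A$ with $\mu(E)>0$ such that $f(x)$ is not an extreme point of $F(x)$ for a.e. $x\in E$. Then there exists $\delta_0>0$ such that for every $\delta\in(0,\delta_0]$ there exists a sequence $\{f_n\}_{n\in\mathbb N}\subset L^1(X)^m$ with the following properties: 1. for all $n\in\mathbb N$, $f_n(x)\in F(x)$ for a.e.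 $x\in X$; 2. $|f_n-f|_{L^1(X)^m}=\delta$ for all $n\in\mathbb N$; 3. $f_n\rightharpoonup f$ weakly in $L^1(X)^m$, i.e. $\varphi(f_n)\to\varphi(f)$ for every continuous linear functional $\varphi$ on $L^1(X)^m$. -/

import Mathlib

open MeasureTheory Filter Topology

/-- A measure is non-atomic if every measurable set of positive measure has a measurable
subset of strictly smaller positive measure. (Mathlib's `NullSingletonClass` only says that
singletons are null, which is weaker on a general measurable space.) -/
def IsNonatomicMeasure {X : Type*} [MeasurableSpace X] (μ : Measure X) : Prop :=
  ∀ A : Set X, MeasurableSet A → 0 < μ A →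
    ∃ B : Set X, MeasurableSet B ∧ B ⊆ A ∧ 0 < μ B ∧ μ B < μ A

/-- A set-valued mapping `F` from a measurable space to a topological space is measurable if
`{x | F x ∩ U ≠ ∅}` is measurable for every open set `U`. -/
def IsMeasurableSetValued {X Y : Type*} [MeasurableSpace X] [TopologicalSpace Y]
    (F : X → Set Y) : Prop :=
  ∀ U : Set Y, IsOpen U → MeasurableSet {x | (F x ∩ U).Nonempty}

namespace IsNonatomicMeasure

variable {X : Type*} [MeasurableSpace X] {μ : Measure X}

theorem restrict (hμ : IsNonatomicMeasure μ) {A : Set X} (hA : MeasurableSet A) :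
    IsNonatomicMeasure (μ.restrict A) := by
  intro B hB hpos
  rw [Measure.restrict_apply hB] at hpos
  obtain ⟨C, hC, hCB, hC0, hC1⟩ := hμ (B ∩ A) (hB.inter hA) hpos
  have hCA : C ∩ A = C := Set.inter_eq_left.2 (hCB.trans Set.inter_subset_right)
  refine ⟨C, hC, hCB.trans Set.inter_subset_left, ?_, ?_⟩
  · rwa [Measure.restrict_apply hC, hCA]
  · rwa [Measure.restrict_apply hC, Measure.restrict_apply hB, hCA]

variable [IsFiniteMeasure μ]

theorem exists_subset_measureReal_le_half (hμ : IsNonatomicMeasure μ) {A : Set X}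
    (hA : MeasurableSet A) (hpos : 0 < μ.real A) :
    ∃ B, MeasurableSet B ∧ B ⊆ A ∧ 0 < μ.real B ∧ μ.real B ≤ μ.real A / 2 := by
  obtain ⟨B, hB, hBA, hB0, hB1⟩ := hμ A hA
    (pos_iff_ne_zero.2 fun h => hpos.ne' (by simp [measureReal_def, h]))
  have h0 : 0 < μ.real B := ENNReal.toReal_pos hB0.ne' (measure_ne_top _ _)
  have h1 : μ.real B < μ.real A :=
    (ENNReal.toReal_lt_toReal (measure_ne_top _ _) (measure_ne_top _ _)).2 hB1
  have h2 : μ.real (A \ B) = μ.real A - μ.real B := measureReal_sdiff hBA hB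
  rcases le_total (μ.real B) (μ.real A / 2) with h | h
  · exact ⟨B, hB, hBA, h0, h⟩
  · exact ⟨A \ B, hA.diff hB, Set.sdiff_subset, by linarith, by linarith⟩

theorem exists_subset_measureReal_lt (hμ : IsNonatomicMeasure μ) {A : Set X}
    (hA : MeasurableSet A) (hpos : 0 < μ.real A) {ε : ℝ} (hε : 0 < ε) :
    ∃ B, MeasurableSet B ∧ B ⊆ A ∧ 0 < μ.real B ∧ μ.real B < ε := by
  have key : ∀ n : ℕ, ∃ B, MeasurableSet B ∧ B ⊆ A ∧ 0 < μ.real B ∧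
      μ.real B ≤ μ.real A * (1 / 2) ^ n := by
    intro n
    induction n with
    | zero => exact ⟨A, hA, subset_rfl, hpos, by simp⟩
    | succ n ih =>
      obtain ⟨B, hB, hBA, hB0, hB1⟩ := ih
      obtain ⟨C, hC, hCB, hC0, hC1⟩ := hμ.exists_subset_measureReal_le_half hB hB0
      refine ⟨C, hC, hCB.trans hBA, hC0, ?_⟩
      rw [pow_succ]
      linarith
  obtain ⟨n, hn⟩ := exists_pow_lt_of_lt_one (div_pos hε hpos) (by norm_num : (1 / 2 : ℝ) < 1)
  obtain ⟨B, hB, hBA, hB0, hB1⟩ := key n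
  exact ⟨B, hB, hBA, hB0, hB1.trans_lt (by rwa [lt_div_iff₀' hpos] at hn)⟩

/-- Sierpiński's theorem: a finite non-atomic measure takes all intermediate values. -/
theorem exists_subset_measureReal_eq (hμ : IsNonatomicMeasure μ) {A : Set X}
    (hA : MeasurableSet A) {t : ℝ} (ht0 : 0 ≤ t) (ht : t ≤ μ.real A) :
    ∃ B, MeasurableSet B ∧ B ⊆ A ∧ μ.real B = t := by
  let S : Type _ := {B : Set X // MeasurableSet B ∧ B ⊆ A ∧ μ.real B ≤ t}
  -- every `B` has an extension whose measure is at least halfway to the supremum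
  have step : ∀ B : S, ∃ C : S, B.1 ⊆ C.1 ∧
      ∀ D : S, B.1 ⊆ D.1 → μ.real D.1 ≤ 2 * μ.real C.1 - μ.real B.1 := by
    intro B
    let V : Set ℝ := (fun D : S => μ.real D.1) '' {D | B.1 ⊆ D.1}
    have hVne : V.Nonempty := ⟨_, B, Set.Subset.refl B.1, rfl⟩
    have hVb : BddAbove V := ⟨t, by rintro _ ⟨D, -, rfl⟩; exact D.2.2.2⟩
    have hBV : μ.real B.1 ≤ sSup V := le_csSup hVb ⟨B, Set.Subset.refl B.1, rfl⟩
    by_cases hlt : μ.real B.1 < sSup V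
    · obtain ⟨_, ⟨C, hBC, rfl⟩, hC⟩ :=
        exists_lt_of_lt_csSup hVne (show (μ.real B.1 + sSup V) / 2 < sSup V by linarith)
      refine ⟨C, hBC, fun D hD => ?_⟩
      have := le_csSup hVb ⟨D, hD, rfl⟩
      dsimp only at hC this
      linarith
    · refine ⟨B, Set.Subset.refl B.1, fun D hD => ?_⟩
      have := le_csSup hVb ⟨D, hD, rfl⟩
      dsimp only at this
      linarith
  choose next hnext hmax using step
  let B : ℕ → S := fun n => next^[n] ⟨∅, MeasurableSet.empty, Set.empty_subset _, by simpa⟩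
  have hBs : ∀ n, B (n + 1) = next (B n) := fun n => Function.iterate_succ_apply' _ _ _
  have hmono : Monotone fun n => (B n).1 :=
    monotone_nat_of_le_succ fun n => by rw [hBs]; exact hnext _
  set U : Set X := ⋃ n, (B n).1 with hU
  have hUm : MeasurableSet U := MeasurableSet.iUnion fun n => (B n).2.1
  have hUA : U ⊆ A := Set.iUnion_subset fun n => (B n).2.2.1
  have hlim : Tendsto (fun n => μ.real (B n).1) atTop (𝓝 (μ.real U)) :=
    (ENNReal.tendsto_toReal (measure_ne_top _ _)).comp (tendsto_measure_iUnion_atTop hmono)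
  have hUt : μ.real U ≤ t := le_of_tendsto' hlim fun n => (B n).2.2.2
  refine ⟨U, hUm, hUA, hUt.antisymm (not_lt.1 fun hlt => ?_)⟩
  have hdiff : μ.real (A \ U) = μ.real A - μ.real U := measureReal_sdiff hUA hUm
  obtain ⟨C, hC, hCA, hC0, hC1⟩ := hμ.exists_subset_measureReal_lt (hA.diff hUm)
    (by linarith) (sub_pos.2 hlt)
  have hUC : μ.real (U ∪ C) = μ.real U + μ.real C :=
    measureReal_union (Set.disjoint_sdiff_right.mono_right hCA) hC
  let D : S := ⟨U ∪ C, hUm.union hC, Set.union_subset hUA (hCA.trans Set.sdiff_subset),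
    by linarith⟩
  have hD : ∀ n, μ.real D.1 ≤ 2 * μ.real (B (n + 1)).1 - μ.real (B n).1 := fun n => by
    rw [hBs]
    exact hmax _ D ((Set.subset_iUnion (fun n => (B n).1) n).trans Set.subset_union_left)
  have := ge_of_tendsto' (((hlim.comp (tendsto_add_atTop_nat 1)).const_mul 2).sub hlim) hD
  change μ.real (U ∪ C) ≤ _ at this
  linarith

/-- A finite non-atomic measure carries a Rademacher sequence: orthogonal functions with values
in `{1, -1}`. -/
theorem exists_rademacher (hμ : IsNonatomicMeasure μ) :
    ∃ r : ℕ → X → ℝ, (∀ n, Measurable (r n)) ∧ (∀ n x, r n x = 1 ∨ r n x = -1) ∧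
      ∀ i j, i ≠ j → ∫ x, r i x * r j x ∂μ = 0 := by
  classical
  have half : ∀ A : Set X, ∃ B, MeasurableSet A →
      MeasurableSet B ∧ B ⊆ A ∧ μ.real B = μ.real A / 2 := by
    intro A
    by_cases hA : MeasurableSet A
    · obtain ⟨B, hB⟩ := hμ.exists_subset_measureReal_eq hA
        (t := μ.real A / 2) (by positivity) (by linarith [measureReal_nonneg (μ := μ) (s := A)])
      exact ⟨B, fun _ => hB⟩
    · exact ⟨∅, fun h => absurd h hA⟩
  choose half hhalf using half
  -- `H c` bisects every fibre of `c`
  let H : (X → ℕ) → Set X := fun c => ⋃ k, half (c ⁻¹' {k})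
  have hHm : ∀ c : X → ℕ, Measurable c → MeasurableSet (H c) := fun c hc =>
    MeasurableSet.iUnion fun k => (hhalf _ (hc (measurableSet_singleton k))).1
  have hHk : ∀ c : X → ℕ, Measurable c → ∀ k, H c ∩ c ⁻¹' {k} = half (c ⁻¹' {k}) := by
    intro c hc k
    ext x
    simp only [H, Set.mem_inter_iff, Set.mem_iUnion]
    constructor
    · rintro ⟨⟨j, hj⟩, hk⟩
      have := (hhalf _ (hc (measurableSet_singleton j))).2.1 hj
      simp only [Set.mem_preimage, Set.mem_singleton_iff] at this hk
      rwa [← hk, this]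
    · intro hx
      exact ⟨⟨k, hx⟩, (hhalf _ (hc (measurableSet_singleton k))).2.1 hx⟩
  let ρ : (X → ℕ) → X → ℝ := fun c x => if x ∈ H c then 1 else -1
  let next : (X → ℕ) → X → ℕ := fun c x => 2 * c x + if x ∈ H c then 1 else 0
  let c : ℕ → X → ℕ := fun n => next^[n] 0
  have hcs : ∀ n, c (n + 1) = next (c n) := fun n => Function.iterate_succ_apply' _ _ _
  have hcm : ∀ n, Measurable (c n) := by
    intro n
    induction n with
    | zero => exact measurable_const
    | succ n ih =>
      rw [hcs]
      exact (ih.const_mul 2).add (Measurable.ite (hHm _ ih) measurable_const measurable_const)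
  have hρm : ∀ n, Measurable (ρ (c n)) := fun n =>
    Measurable.ite (hHm _ (hcm n)) measurable_const measurable_const
  have hρv : ∀ n x, ρ (c n) x = 1 ∨ ρ (c n) x = -1 := fun n x => by
    simp only [ρ]
    split_ifs <;> simp
  -- earlier functions are determined by later codes
  have hfactor : ∀ i k, ∃ σ : ℕ → ℝ, ∀ x, ρ (c i) x = σ (c (i + 1 + k) x) := by
    intro i k
    induction k with
    | zero =>
      refine ⟨fun a => if a % 2 = 1 then 1 else -1, fun x => ?_⟩
      simp only [add_zero, hcs, next, ρ]
      by_cases hx : x ∈ H (c i)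
      · simp [hx, Nat.add_mod]
      · simp [hx]
    | succ k ih =>
      obtain ⟨σ, hσ⟩ := ih
      refine ⟨fun a => σ (a / 2), fun x => ?_⟩
      rw [hσ, ← add_assoc, hcs]
      simp only [next]
      congr 1
      split_ifs <;> omega
  have hint : ∀ i j, Integrable (fun x => ρ (c i) x * ρ (c j) x) μ := fun i j =>
    Integrable.of_bound ((hρm i).mul (hρm j)).aestronglyMeasurable 1 (ae_of_all _ fun x => by
      rcases hρv i x with h | h <;> rcases hρv j x with h' | h' <;> simp [h, h'])
  have hρint : ∀ n k, ∫ x in c n ⁻¹' {k}, ρ (c n) x ∂μ = 0 := by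
    intro n k
    have hfib : MeasurableSet (c n ⁻¹' {k}) := hcm n (measurableSet_singleton k)
    have heq : ∀ x, ρ (c n) x = 2 * (H (c n)).indicator 1 x - 1 := fun x => by
      by_cases hx : x ∈ H (c n)
      · simp only [ρ, hx, if_true, Set.indicator_of_mem, Pi.one_apply]; norm_num
      · simp only [ρ, hx, if_false, not_false_eq_true, Set.indicator_of_notMem]; norm_num
    have hHint : Integrable ((H (c n)).indicator (1 : X → ℝ)) (μ.restrict (c n ⁻¹' {k})) :=
      (integrable_const (1 : ℝ)).indicator (hHm _ (hcm n))
    simp_rw [heq]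
    rw [integral_sub (hHint.const_mul 2) (integrable_const _), integral_const_mul,
      integral_indicator_one (hHm _ (hcm n)), integral_const,
      measureReal_restrict_apply (hHm _ (hcm n)), hHk _ (hcm n), (hhalf _ hfib).2.2,
      measureReal_restrict_apply MeasurableSet.univ, Set.univ_inter]
    simp
    ring
  have hlt : ∀ i j, i < j → ∫ x, ρ (c i) x * ρ (c j) x ∂μ = 0 := by
    intro i j hij
    obtain ⟨k, rfl⟩ := Nat.exists_eq_add_of_le hij
    obtain ⟨σ, hσ⟩ := hfactor i k
    set j := i + 1 + k
    have huniv : ⋃ a, c j ⁻¹' {a} = Set.univ := by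
      rw [← Set.preimage_iUnion, Set.iUnion_of_singleton, Set.preimage_univ]
    have hfib : ∀ a, MeasurableSet (c j ⁻¹' {a}) := fun a => hcm j (measurableSet_singleton a)
    rw [← setIntegral_univ, ← huniv, integral_iUnion hfib
      (fun a b hab => Disjoint.preimage _ (by simpa using hab)) (hint i j).integrableOn]
    refine (tsum_congr fun a => ?_).trans tsum_zero
    rw [setIntegral_congr_fun (g := fun x => σ a * ρ (c j) x) (hfib a) fun x hx => ?_,
      integral_const_mul, hρint, mul_zero]
    have : c j x = a := hx
    simp only [hσ, this]
  refine ⟨fun n => ρ (c n), hρm, hρv, fun i j hij => ?_⟩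
  rcases hij.lt_or_gt with h | h
  · exact hlt i j h
  · simpa only [mul_comm] using hlt j i h

end IsNonatomicMeasure

/-- Measurable projection onto the zero sets of a nonnegative Carathéodory function. -/
theorem exists_measurable_nearest_zero {X H : Type*} [MeasurableSpace X]
    [NormedAddCommGroup H] [InnerProductSpace ℝ H] [FiniteDimensional ℝ H] [MeasurableSpace H]
    [BorelSpace H] {ψ : X → H → ℝ} (hψm : ∀ v, Measurable fun x => ψ x v)
    (hψc : ∀ x, Continuous (ψ x)) (hψ0 : ∀ x v, 0 ≤ ψ x v)
    (hne : ∀ x, ∃ v, ψ x v = 0) (hcvx : ∀ x, Convex ℝ {v | ψ x v = 0}) (w : H) :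
    ∃ g : X → H, Measurable g ∧ (∀ x, ψ x (g x) = 0) ∧
      ∀ x v, ψ x v = 0 → ‖w - g x‖ ≤ ‖w - v‖ := by
  classical
  have : ProperSpace H := FiniteDimensional.proper ℝ H
  have hclosed : ∀ x, IsClosed {v | ψ x v = 0} := fun x => isClosed_eq (hψc x) continuous_const
  have hproj : ∀ x, ∃ g, ψ x g = 0 ∧ ∀ v, ψ x v = 0 → ‖w - g‖ ≤ ‖w - v‖ := fun x => by
    obtain ⟨g, hg, hd⟩ := (hclosed x).exists_infDist_eq_dist (hne x) w
    refine ⟨g, hg, fun v hv => ?_⟩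
    rw [← dist_eq_norm, ← dist_eq_norm, ← hd]
    exact Metric.infDist_le_dist_of_mem hv
  choose g hg hgmin using hproj
  have huniq : ∀ x v, ψ x v = 0 → ‖w - v‖ ≤ ‖w - g x‖ → v = g x := by
    intro x v hv hle
    have heq : ‖w - v‖ = ‖w - g x‖ := hle.antisymm (hgmin x v hv)
    have hmid := hgmin x _ (hcvx x hv (hg x) (by norm_num : (0 : ℝ) ≤ 1 / 2)
      (by norm_num : (0 : ℝ) ≤ 1 / 2) (by norm_num))
    have hpar := parallelogram_law_with_norm ℝ (w - v) (w - g x)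
    have hsum : ‖(w - v) + (w - g x)‖ = 2 * ‖w - ((1 / 2 : ℝ) • v + (1 / 2 : ℝ) • g x)‖ := by
      have h2 : (w - v) + (w - g x) =
          (2 : ℝ) • (w - ((1 / 2 : ℝ) • v + (1 / 2 : ℝ) • g x)) := by module
      rw [h2, norm_smul, Real.norm_ofNat]
    have hdif : ‖(w - v) - (w - g x)‖ = ‖v - g x‖ := by
      rw [← norm_neg]
      congr 1
      abel
    rw [hsum, hdif, heq] at hpar
    have h0 : ‖v - g x‖ = 0 := by
      have := norm_nonneg (w - g x)
      nlinarith [norm_nonneg (v - g x)]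
    exact sub_eq_zero.1 (norm_eq_zero.1 h0)
  -- approximate minimisers of the penalised distance
  let Φ : ℕ → X → H → ℝ := fun n x v => (n + 1) * ψ x v + ‖w - v‖
  let d : ℕ → H := TopologicalSpace.denseSeq H
  have hΦm : ∀ n v, Measurable fun x => Φ n x v := fun n v =>
    ((hψm v).const_mul _).add_const _
  have hΦc : ∀ n x, Continuous (Φ n x) := fun n x => by
    have := hψc x
    fun_prop
  have hΦ0 : ∀ n x v, 0 ≤ Φ n x v := fun n x v => by
    have := hψ0 x v
    positivity
  have hbdd : ∀ n x, BddBelow (Set.range fun i => Φ n x (d i)) := fun n x =>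
    ⟨0, by rintro _ ⟨i, rfl⟩; exact hΦ0 n x _⟩
  have hinf : ∀ n x v, ⨅ i, Φ n x (d i) ≤ Φ n x v := by
    intro n x v
    refine (TopologicalSpace.denseRange_denseSeq H).induction_on
      (p := fun v => ⨅ i, Φ n x (d i) ≤ Φ n x v) v
      (isClosed_le continuous_const (hΦc n x)) fun i => ciInf_le (hbdd n x) i
  have hex : ∀ n x, ∃ i, Φ n x (d i) < (⨅ i, Φ n x (d i)) + 1 / ((n : ℝ) + 1) := fun n x =>
    exists_lt_of_ciInf_lt (lt_add_of_pos_right _ (by positivity))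
  let a : ℕ → X → H := fun n x => d (Nat.find (hex n x))
  have ham : ∀ n, Measurable (a n) := fun n =>
    (measurable_from_nat (f := d)).comp (measurable_find (hex n) fun i =>
      measurableSet_lt (hΦm n _) ((Measurable.iInf fun i => hΦm n (d i)).add_const _))
  have hale : ∀ n x, Φ n x (a n x) ≤ ‖w - g x‖ + 1 / ((n : ℝ) + 1) := fun n x => by
    refine (Nat.find_spec (hex n x)).le.trans ?_
    have := hinf n x (g x)
    simp only [Φ, hg, mul_zero, zero_add] at this ⊢
    linarith
  have hlim1 : Tendsto (fun n : ℕ => 1 / ((n : ℝ) + 1)) atTop (𝓝 0) :=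
    tendsto_one_div_add_atTop_nhds_zero_nat
  have hdist : ∀ n x, ‖w - a n x‖ ≤ ‖w - g x‖ + 1 / ((n : ℝ) + 1) := fun n x => by
    refine le_trans ?_ (hale n x)
    have : 0 ≤ ((n : ℝ) + 1) * ψ x (a n x) := mul_nonneg (by positivity) (hψ0 _ _)
    simp only [Φ]
    linarith
  have hsmall : ∀ n x, ψ x (a n x) ≤ (‖w - g x‖ + 1) * (1 / ((n : ℝ) + 1)) := fun n x => by
    have h1 := hale n x
    have h2 : 1 / ((n : ℝ) + 1) ≤ 1 := by
      rw [div_le_one (by positivity)]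
      linarith [(Nat.cast_nonneg n : (0 : ℝ) ≤ n)]
    rw [mul_one_div, le_div_iff₀ (by positivity)]
    simp only [Φ] at h1
    linarith [norm_nonneg (w - a n x)]
  have hlim : ∀ x, Tendsto (fun n => a n x) atTop (𝓝 (g x)) := by
    intro x
    refine (isCompact_closedBall w (‖w - g x‖ + 1)).tendsto_nhds_of_unique_mapClusterPt
      (Eventually.of_forall fun n => ?_) fun v _ hv => ?_
    · rw [mem_closedBall_iff_norm']
      refine (hdist n x).trans (add_le_add_right ?_ _)
      rw [div_le_one (by positivity)]
      linarith [(Nat.cast_nonneg n : (0 : ℝ) ≤ n)]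
    · obtain ⟨φ, hφ, hφv⟩ := hv.tendsto_subseq
      have hlimφ := hlim1.comp hφ.tendsto_atTop
      refine huniq x v (le_antisymm ?_ (hψ0 x v)) ?_
      · have h := le_of_tendsto_of_tendsto' (((hψc x).tendsto v).comp hφv)
          (hlimφ.const_mul (‖w - g x‖ + 1)) fun n => hsmall (φ n) x
        simpa using h
      · have h := le_of_tendsto_of_tendsto' ((hφv.const_sub w).norm)
          (hlimφ.const_add ‖w - g x‖) fun n => hdist (φ n) x
        simpa using h
  exact ⟨g, measurable_of_tendsto_metrizable ham (tendsto_pi_nhds.2 hlim), hg, hgmin⟩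

theorem IsMeasurableSetValued.measurable_infDist {X Y : Type*} [MeasurableSpace X]
    [PseudoMetricSpace Y] {F : X → Set Y} (hF : IsMeasurableSetValued F)
    (hne : ∀ x, (F x).Nonempty) (y : Y) : Measurable fun x => Metric.infDist y (F x) := by
  refine measurable_of_Iio fun r => ?_
  convert hF (Metric.ball y r) Metric.isOpen_ball using 1
  ext x
  simp only [Set.mem_preimage, Set.mem_Iio, Metric.infDist_lt_iff (hne x), Set.mem_ofPred_eq,
    Set.Nonempty, Set.mem_inter_iff, Metric.mem_ball, dist_comm y]

theorem IsMeasurableSetValued.measurable_infDist_comp {X Y : Type*} [MeasurableSpace X]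
    [MetricSpace Y] [SecondCountableTopology Y] [MeasurableSpace Y] [OpensMeasurableSpace Y]
    {F : X → Set Y} (hF : IsMeasurableSetValued F) (hne : ∀ x, (F x).Nonempty) {f : X → Y}
    (hf : Measurable f) : Measurable fun x => Metric.infDist (f x) (F x) := by
  have h : Measurable (Function.uncurry fun y x => Metric.infDist y (F x)) :=
    measurable_uncurry_of_continuous_of_measurable
      (fun x => Metric.continuous_infDist_pt (F x)) (hF.measurable_infDist hne)
  have h' : Measurable fun x => (f x, x) := hf.prodMk measurable_id
  have h'' := h.comp h'
  simpa only [Function.comp_def, Function.uncurry_apply_pair] using h''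

theorem exists_ne_zero_add_sub_mem_of_notMem_extremePoints {E : Type*} [AddCommGroup E]
    [Module ℝ E] {C : Set E} (hC : Convex ℝ C) {p : E} (hp : p ∈ C)
    (hext : p ∉ C.extremePoints ℝ) : ∃ v ≠ 0, p + v ∈ C ∧ p - v ∈ C := by
  rw [mem_extremePoints_iff_left] at hext
  push Not at hext
  obtain ⟨a, ha, b, hb, ⟨s, t, hs, ht, hst, rfl⟩, hne⟩ := hext hp
  have hab : a - b ≠ 0 := fun h => hne <| by
    rw [sub_eq_zero.1 h, ← add_smul, hst, one_smul]
  refine ⟨min s t • (a - b), smul_ne_zero (lt_min hs ht).ne' hab, ?_, ?_⟩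
  · convert hC ha hb (add_pos hs (lt_min hs ht)).le (sub_nonneg.2 (min_le_right s t))
      (by linarith) using 1
    module
  · convert hC ha hb (sub_nonneg.2 (min_le_left s t)) (add_pos ht (lt_min hs ht)).le
      (by linarith) using 1
    module

/-- A measurable selection of a convex-valued map that is not extreme on a set of positive measure
admits a bounded measurable symmetric perturbation, nonzero on a set of positive measure. -/
theorem exists_measurable_symmetric_perturbation {X H : Type*} [MeasurableSpace X] {μ : Measure X}
    [NormedAddCommGroup H] [InnerProductSpace ℝ H] [FiniteDimensional ℝ H] [MeasurableSpace H]
    [BorelSpace H] {F : X → Set H} (hF : IsMeasurableSetValued F) (hne : ∀ x, (F x).Nonempty)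
    (hcl : ∀ x, IsClosed (F x)) (hcvx : ∀ x, Convex ℝ (F x)) {f : X → H} (hfm : Measurable f)
    (hf : ∀ᵐ x ∂μ, f x ∈ F x) {E : Set X} (hE : 0 < μ E)
    (hext : ∀ᵐ x ∂μ, x ∈ E → f x ∉ (F x).extremePoints ℝ) :
    ∃ g : X → H, ∃ C : ℝ, Measurable g ∧ (∀ x, ‖g x‖ ≤ C) ∧ 0 < μ {x | g x ≠ 0} ∧
      ∀ᵐ x ∂μ, f x + g x ∈ F x ∧ f x - g x ∈ F x := by
  classical
  have : ProperSpace H := FiniteDimensional.proper ℝ H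
  have hmem : ∀ x y, Metric.infDist y (F x) = 0 ↔ y ∈ F x := fun x y =>
    ((hcl x).mem_iff_infDist_zero (hne x)).symm
  let ψ : X → H → ℝ := fun x v => if Metric.infDist (f x) (F x) = 0 then
    Metric.infDist (f x + v) (F x) + Metric.infDist (f x - v) (F x) else ‖v‖
  have hψ : ∀ x v, ψ x v = 0 ↔ if f x ∈ F x then f x + v ∈ F x ∧ f x - v ∈ F x else v = 0 := by
    intro x v
    simp only [ψ, hmem]
    split_ifs
    · rw [add_eq_zero_iff_of_nonneg Metric.infDist_nonneg Metric.infDist_nonneg, hmem, hmem]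
    · exact norm_eq_zero
  have hψz : ∀ x, ψ x 0 = 0 := fun x => by
    rw [hψ]
    split_ifs with h
    · simpa
    · rfl
  have hψm : ∀ v, Measurable fun x => ψ x v := fun v =>
    Measurable.ite (hF.measurable_infDist_comp hne hfm (measurableSet_singleton 0))
      ((hF.measurable_infDist_comp hne (hfm.add_const v)).add
        (hF.measurable_infDist_comp hne (hfm.sub_const v))) measurable_const
  have hψc : ∀ x, Continuous (ψ x) := fun x => by
    by_cases h : Metric.infDist (f x) (F x) = 0
    · simp only [ψ, h, if_true]
      exact ((Metric.continuous_infDist_pt _).comp (by fun_prop)).add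
        ((Metric.continuous_infDist_pt _).comp (by fun_prop))
    · simp only [ψ, h, if_false]
      fun_prop
  have hψ0 : ∀ x v, 0 ≤ ψ x v := fun x v => by
    simp only [ψ]
    split_ifs
    · exact add_nonneg Metric.infDist_nonneg Metric.infDist_nonneg
    · exact norm_nonneg v
  have hψcvx : ∀ x, Convex ℝ {v | ψ x v = 0} := fun x => by
    simp only [hψ]
    by_cases h : f x ∈ F x
    · simp only [h, if_true]
      intro u hu v hv a b ha hb hab
      constructor
      · convert hcvx x hu.1 hv.1 ha hb hab using 1
        linear_combination (norm := module) hab • (-f x)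
      · convert hcvx x hu.2 hv.2 ha hb hab using 1
        linear_combination (norm := module) hab • (-f x)
    · simp only [h, if_false, Set.ofPred_eq_eq_singleton]
      exact convex_singleton 0
  choose g hgm hg hgmin using fun w : H =>
    exists_measurable_nearest_zero hψm hψc hψ0 (fun x => ⟨0, hψz x⟩) hψcvx w
  have hcover : ∀ᵐ x ∂μ, x ∈ E → x ∈ ⋃ n, {x | g (TopologicalSpace.denseSeq H n) x ≠ 0} := by
    filter_upwards [hf, hext] with x hx hxE hE
    obtain ⟨v, hv0, hv⟩ := exists_ne_zero_add_sub_mem_of_notMem_extremePoints (hcvx x) hx (hxE hE)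
    obtain ⟨n, hn⟩ := (TopologicalSpace.denseRange_denseSeq H).exists_dist_lt v
      (half_pos (norm_pos_iff.2 hv0))
    refine Set.mem_iUnion.2 ⟨n, fun h0 => ?_⟩
    set w := TopologicalSpace.denseSeq H n
    have h1 := hgmin w x v (by rw [hψ, if_pos hx]; exact hv)
    rw [h0, sub_zero] at h1
    rw [dist_eq_norm, norm_sub_rev] at hn
    have h2 : ‖v‖ ≤ ‖w‖ + ‖w - v‖ := by
      simpa using norm_sub_le w (w - v)
    linarith
  have hpos : 0 < μ (⋃ n, {x | g (TopologicalSpace.denseSeq H n) x ≠ 0}) :=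
    hE.trans_le (measure_mono_ae hcover)
  obtain ⟨n, hn⟩ := exists_measure_pos_of_not_measure_iUnion_null hpos.ne'
  set w := TopologicalSpace.denseSeq H n
  refine ⟨g w, ‖w‖ + ‖w‖, hgm w, fun x => ?_, hn, ?_⟩
  · have h1 := hgmin w x 0 (hψz x)
    rw [sub_zero] at h1
    have h2 := norm_sub_le w (w - g w x)
    rw [sub_sub_cancel] at h2
    linarith
  · filter_upwards [hf] with x hx
    have := (hψ x _).1 (hg w x)
    rwa [if_pos hx] at this

theorem tendsto_toWeakSpace_iff {E ι : Type*} [AddCommGroup E] [Module ℝ E] [TopologicalSpace E]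
    {l : Filter ι} {u : ι → E} {x : E} :
    Tendsto (fun i => toWeakSpace ℝ E (u i)) l (𝓝 (toWeakSpace ℝ E x)) ↔
      ∀ φ : StrongDual ℝ E, Tendsto (fun i => φ (u i)) l (𝓝 (φ x)) := by
  have h : IsInducing fun (y : WeakSpace ℝ E) (φ : StrongDual ℝ E) =>
      (topDualPairing ℝ E).flip ((toWeakSpace ℝ E).symm y) φ := ⟨rfl⟩
  rw [h.tendsto_nhds_iff, tendsto_pi_nhds]
  rfl

/-- A Rademacher sequence times a bounded function of finite support tends weakly to zero
in `L¹`. -/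
theorem tendsto_dual_rademacher_smul {X H : Type*} [MeasurableSpace X] {μ : Measure X}
    [NormedAddCommGroup H] [NormedSpace ℝ H] {A : Set X} (hAfin : μ A ≠ ⊤)
    {r : ℕ → X → ℝ} (hrm : ∀ n, Measurable (r n)) (hr : ∀ n x, r n x = 1 ∨ r n x = -1)
    (horth : ∀ i j, i ≠ j → ∫ x in A, r i x * r j x ∂μ = 0)
    {g : X → H} {C : ℝ} (hgC : ∀ x, ‖g x‖ ≤ C) (hgA : ∀ x ∉ A, g x = 0)
    {v : ℕ → Lp H 1 μ} (hv : ∀ n, v n =ᵐ[μ] fun x => r n x • g x)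
    (φ : StrongDual ℝ (Lp H 1 μ)) : Tendsto (fun n => φ (v n)) atTop (𝓝 0) := by
  have : IsFiniteMeasure (μ.restrict A) := isFiniteMeasure_restrict.2 hAfin
  set a : ℝ := (μ.restrict A).real Set.univ with ha
  have ha0 : 0 ≤ a := measureReal_nonneg
  set c : ℕ → ℝ := fun n => φ (v n) with hc
  have hint : ∀ i j, Integrable (fun x => r i x * r j x) (μ.restrict A) := fun i j =>
    Integrable.of_bound ((hrm i).mul (hrm j)).aestronglyMeasurable 1 (ae_of_all _ fun x => by
      rcases hr i x with h | h <;> rcases hr j x with h' | h' <;> simp [h, h'])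
  have hr1 : ∀ n, Integrable (r n) (μ.restrict A) := fun n =>
    Integrable.of_bound (hrm n).aestronglyMeasurable 1 (ae_of_all _ fun x => by
      rcases hr n x with h | h <;> simp [h])
  have hbound : ∀ N, ∑ n ∈ Finset.range N, c n ^ 2 ≤ (‖φ‖ * C) ^ 2 * a ^ 2 := by
    intro N
    set S := ∑ n ∈ Finset.range N, c n ^ 2 with hS
    set h : X → ℝ := fun x => ∑ n ∈ Finset.range N, c n * r n x with hh
    have hhint : Integrable h (μ.restrict A) :=
      integrable_finsetSum _ fun n _ => (hr1 n).const_mul _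
    have hsq : ∀ x, h x ^ 2 = ∑ i ∈ Finset.range N, ∑ j ∈ Finset.range N,
        c i * c j * (r i x * r j x) := fun x => by
      rw [sq, hh, Finset.sum_mul_sum]
      exact Finset.sum_congr rfl fun i _ => Finset.sum_congr rfl fun j _ => by ring
    have hsqint : Integrable (fun x => h x ^ 2) (μ.restrict A) := by
      simp_rw [hsq]
      exact integrable_finsetSum _ fun i _ => integrable_finsetSum _ fun j _ =>
        (hint i j).const_mul _
    have hself : ∀ i, ∫ x in A, r i x * r i x ∂μ = a := fun i => by
      have : ∀ x, r i x * r i x = 1 := fun x => by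
        rcases hr i x with h | h <;> simp [h]
      simp [this, ha]
    have hsqval : ∫ x in A, h x ^ 2 ∂μ = a * S := by
      simp_rw [hsq]
      rw [integral_finsetSum _ fun i _ => integrable_finsetSum _ fun j _ =>
        (hint i j).const_mul _, hS, Finset.mul_sum]
      refine Finset.sum_congr rfl fun i hi => ?_
      rw [integral_finsetSum _ fun j _ => (hint i j).const_mul _, Finset.sum_eq_single_of_mem i hi]
      · rw [integral_const_mul, hself]
        ring
      · intro j _ hji
        rw [integral_const_mul, horth i j hji.symm, mul_zero]
    have hcoe : (∑ n ∈ Finset.range N, c n • v n : Lp H 1 μ) =ᵐ[μ] fun x => h x • g x := by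
      have h1 : ∀ n, (c n • v n : Lp H 1 μ) =ᵐ[μ] fun x => (c n * r n x) • g x := fun n => by
        filter_upwards [Lp.coeFn_smul (c n) (v n), hv n] with x hx1 hx2
        rw [hx1, Pi.smul_apply, hx2, smul_smul]
      filter_upwards [Lp.coeFn_finsetSum (Finset.range N) fun n => c n • v n,
        ae_all_iff.2 h1] with x hx1 hx2
      rw [hx1, Finset.sum_apply, hh, Finset.sum_smul]
      exact Finset.sum_congr rfl fun n _ => hx2 n
    have hnorm : ‖∑ n ∈ Finset.range N, c n • v n‖ ≤ C * ∫ x in A, |h x| ∂μ := by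
      have hae : ∀ᵐ x ∂μ, ‖(∑ n ∈ Finset.range N, c n • v n : Lp H 1 μ) x‖ = ‖h x • g x‖ :=
        hcoe.fun_comp norm
      rw [L1.norm_eq_integral_norm, integral_congr_ae hae,
        ← setIntegral_eq_integral_of_forall_compl_eq_zero (s := A)
          (fun x hx => by simp [hgA x hx]), ← integral_const_mul]
      refine integral_mono_of_nonneg (ae_of_all _ fun x => norm_nonneg _)
        (hhint.abs.const_mul C) (ae_of_all _ fun x => ?_)
      simp only [norm_smul, Real.norm_eq_abs]
      rw [mul_comm C]
      exact mul_le_mul_of_nonneg_left (hgC x) (abs_nonneg _)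
    have hS1 : S ≤ ‖φ‖ * (C * ∫ x in A, |h x| ∂μ) := by
      have h1 : S = φ (∑ n ∈ Finset.range N, c n • v n) := by
        simp [hS, hc, sq]
      rw [h1]
      exact (le_abs_self _).trans ((φ.le_opNorm _).trans
        (mul_le_mul_of_nonneg_left hnorm (norm_nonneg φ)))
    have hCS : (∫ x in A, |h x| ∂μ) ^ 2 ≤ a * (a * S) := by
      set I := ∫ x in A, |h x| ∂μ with hI
      have h0 : 0 ≤ ∫ x in A, (a * |h x| - I) ^ 2 ∂μ := integral_nonneg fun x => sq_nonneg _
      have h1 : ∀ x, (a * |h x| - I) ^ 2 = a ^ 2 * h x ^ 2 - 2 * a * I * |h x| + I ^ 2 :=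
        fun x => by rw [← sq_abs (h x)]; ring
      simp_rw [h1] at h0
      have hi1 : Integrable (fun x => a ^ 2 * h x ^ 2) (μ.restrict A) := hsqint.const_mul _
      have hi2 : Integrable (fun x => 2 * a * I * |h x|) (μ.restrict A) := hhint.abs.const_mul _
      have hi3 : Integrable (fun x => a ^ 2 * h x ^ 2 - 2 * a * I * |h x|) (μ.restrict A) :=
        hi1.sub hi2
      rw [integral_add hi3 (integrable_const _), integral_sub hi1 hi2, integral_const_mul,
        integral_const_mul, hsqval, integral_const, ← ha, ← hI, smul_eq_mul] at h0
      rcases ha0.eq_or_lt with h | h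
      · have : (μ.restrict A) = 0 := by
          rw [← Measure.measure_univ_eq_zero]
          rwa [ha, eq_comm, measureReal_eq_zero_iff] at h
        simp [hI, this, ← h]
      · have h2 : 0 ≤ a * (a * (a * S) - I ^ 2) := by linarith
        linarith [nonneg_of_mul_nonneg_right h2 h]
    have hS0 : 0 ≤ S := Finset.sum_nonneg fun n _ => sq_nonneg _
    have hI0 : 0 ≤ ∫ x in A, |h x| ∂μ := integral_nonneg fun x => abs_nonneg _
    have h1 : S ^ 2 ≤ (‖φ‖ * C) ^ 2 * (a * (a * S)) :=
      calc S ^ 2 ≤ (‖φ‖ * (C * ∫ x in A, |h x| ∂μ)) ^ 2 := pow_le_pow_left₀ hS0 hS1 2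
        _ = (‖φ‖ * C) ^ 2 * (∫ x in A, |h x| ∂μ) ^ 2 := by ring
        _ ≤ _ := mul_le_mul_of_nonneg_left hCS (sq_nonneg _)
    rcases hS0.eq_or_lt with h | h
    · rw [← h]
      positivity
    · refine le_of_mul_le_mul_right ?_ h
      linarith
  have hsum : Summable fun n => c n ^ 2 :=
    summable_of_sum_range_le (fun n => sq_nonneg _) hbound
  have := hsum.tendsto_atTop_zero.sqrt
  simp only [Real.sqrt_sq_eq_abs, Real.sqrt_zero] at this
  exact (tendsto_zero_iff_abs_tendsto_zero _).2 this

theorem theoremA9 {X : Type*} [MeasurableSpace X] (μ : Measure X) [SigmaFinite μ]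
    (hμ : IsNonatomicMeasure μ) (m : ℕ)
    (F : X → Set (EuclideanSpace ℝ (Fin m)))
    (hF : IsMeasurableSetValued F)
    (hFne : ∀ x, (F x).Nonempty) (hFcpt : ∀ x, IsCompact (F x)) (hFcvx : ∀ x, Convex ℝ (F x))
    (f : Lp (EuclideanSpace ℝ (Fin m)) 1 μ)
    (hf : ∀ᵐ x ∂μ, f x ∈ F x)
    (hE : ∃ E : Set X, MeasurableSet E ∧ 0 < μ E ∧
      ∀ᵐ x ∂μ, x ∈ E → f x ∉ Set.extremePoints ℝ (F x)) :
    ∃ δ₀ : ℝ, 0 < δ₀ ∧ ∀ δ : ℝ, 0 < δ → δ ≤ δ₀ →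
      ∃ u : ℕ → Lp (EuclideanSpace ℝ (Fin m)) 1 μ,
        (∀ n, ∀ᵐ x ∂μ, u n x ∈ F x) ∧
        (∀ n, ‖u n - f‖ = δ) ∧
        Tendsto (fun n => toWeakSpace ℝ (Lp (EuclideanSpace ℝ (Fin m)) 1 μ) (u n)) atTop
          (𝓝 (toWeakSpace ℝ (Lp (EuclideanSpace ℝ (Fin m)) 1 μ) f)) := by
  obtain ⟨E, -, hEpos, hext⟩ := hE
  obtain ⟨g, C, hgm, hgC, hgpos, hgF⟩ := exists_measurable_symmetric_perturbation hF hFne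
    (fun x => (hFcpt x).isClosed) hFcvx (Lp.stronglyMeasurable f).measurable hf hEpos hext
  obtain ⟨A, hA, hAg, hApos, hAfin⟩ := Measure.exists_subset_measure_lt_top
    (hgm (measurableSet_singleton 0).compl) hgpos
  have : IsFiniteMeasure (μ.restrict A) := isFiniteMeasure_restrict.2 hAfin.ne
  obtain ⟨r, hrm, hr, horth⟩ := (hμ.restrict hA).exists_rademacher
  have hgint : IntegrableOn g A μ :=
    Integrable.of_bound hgm.aestronglyMeasurable C (ae_of_all _ hgC)
  refine ⟨∫ x in A, ‖g x‖ ∂μ, ?_, fun δ hδ hδle => ?_⟩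
  · refine (setIntegral_pos_iff_support_of_nonneg_ae (ae_of_all _ fun x => norm_nonneg _)
      hgint.norm).2 (hApos.trans_le (measure_mono fun x hx => ⟨?_, hx⟩))
    simpa using hAg hx
  set δ₀ := ∫ x in A, ‖g x‖ ∂μ
  have hδ₀ : 0 < δ₀ := hδ.trans_le hδle
  set t : ℝ := δ / δ₀ with ht
  have ht0 : 0 < t := div_pos hδ hδ₀
  have ht1 : t ≤ 1 := (div_le_one hδ₀).2 hδle
  let k : X → EuclideanSpace ℝ (Fin m) := A.indicator fun x => t • g x
  have hkm : Measurable k := (hgm.const_smul t).indicator hA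
  have hkC : ∀ x, ‖k x‖ ≤ C := fun x =>
    (norm_indicator_le_norm_self _ _).trans <| by
      rw [norm_smul, Real.norm_of_nonneg ht0.le]
      exact (mul_le_of_le_one_left (norm_nonneg _) ht1).trans (hgC x)
  have hkint : Integrable k μ := (integrable_indicator_iff hA).2 (hgint.smul t)
  have hrnorm : ∀ n x, ‖r n x • k x‖ = ‖k x‖ := fun n x => by
    rcases hr n x with h | h <;> simp [h]
  have hrk : ∀ n, MemLp (fun x => r n x • k x) 1 μ := fun n => by
    rw [memLp_one_iff_integrable]
    exact hkint.mono ((hrm n).smul hkm).aestronglyMeasurable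
      (ae_of_all _ fun x => (hrnorm n x).le)
  let v : ℕ → Lp (EuclideanSpace ℝ (Fin m)) 1 μ := fun n => (hrk n).toLp
  have hv : ∀ n, v n =ᵐ[μ] fun x => r n x • k x := fun n => (hrk n).coeFn_toLp
  refine ⟨fun n => f + v n, fun n => ?_, fun n => ?_, ?_⟩
  · filter_upwards [Lp.coeFn_add f (v n), hv n, hgF, hf] with x hx hvx hgx hfx
    rw [hx, Pi.add_apply, hvx]
    by_cases hxA : x ∈ A
    · simp only [k, Set.indicator_of_mem hxA]
      rcases hr n x with h | h
      · rw [h, one_smul]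
        exact (hFcvx x).add_smul_mem hfx hgx.1 ⟨ht0.le, ht1⟩
      · rw [h, neg_one_smul, ← smul_neg]
        exact (hFcvx x).add_smul_mem hfx (by rw [← sub_eq_add_neg]; exact hgx.2) ⟨ht0.le, ht1⟩
    · simpa [k, hxA] using hfx
  · have hae : ∀ᵐ x ∂μ, ‖v n x‖ = ‖r n x • k x‖ := (hv n).fun_comp norm
    rw [add_sub_cancel_left, L1.norm_eq_integral_norm, integral_congr_ae hae]
    simp only [hrnorm]
    simp only [k, norm_indicator_eq_indicator_norm]
    rw [integral_indicator hA]
    simp only [norm_smul, Real.norm_of_nonneg ht0.le]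
    rw [integral_const_mul, ht]
    exact div_mul_cancel₀ δ hδ₀.ne'
  · rw [tendsto_toWeakSpace_iff]
    intro φ
    have := tendsto_dual_rademacher_smul hAfin.ne hrm hr horth hkC
      (fun x hx => Set.indicator_of_notMem hx _) hv φ
    simpa using this.const_add (φ f)
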